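/- Let $n\ge 2$, $\sigma>0$, $\mu\in\mathbb{R}$, and let $X_1,\dots,X_n$ be i.i.d. $\mathrm{N}(\mu,\sigma^2)$ random variables. Consider the normal model with parameter $\theta=(\theta_1,\theta_2)=(\text{mean},\text{variance})\in\Theta=\mathbb{R}\times(0,\infty)$, likelihood $L(\theta;x)=\prod_{i=1}^n (2\pi\theta_2)^{-1/2}e^{-(x_i-\theta_1)^2/(2\theta_2)}$, and the test of $H_0:\mu=0$, that is, $\Theta_0=\{\theta\in\Theta:\theta_1=0\}$, against the general alternative $\theta\in\Theta$. Almost surely, $L(\cdot;X)$ has a unique maximiser over $\Theta$, namely $\hat\theta_n(X)=\bigl(\bar X,\frac1n\sum_{i=1}^n(X_i-\bar X)^2\bigr)$ with $\bar X=\frac1n\sum_{i=1}^n X_i$, and a unique maximiser over $\Theta_0$, namely $\hat\theta^{\mathrm{res}}(X)=\bigl(0,\frac1n\sum_{i=1}^nX_i^2\bigr)$. Let $$-2\log\Lambda = 2\log\frac{T_1}{T_2},\qquad T_1=\frac{L(\hat\theta_n(X);X)}{L((\mu,\sigma^2);X)},\quad T_2=\frac{L(\hat\theta^{\mathrm{res}}(X);X)}{L((\mu,\sigma^2);X)},$$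 be the log-likelihood ratio statistic. If $H_0$ holds, i.e. $\mu=0$, then for $K\sim\chi^2_1$ and every bounded, twice continuously differentiable $h:\mathbb{R}\to\mathbb{R}$ with bounded first and second derivatives, $$\bigl|\mathbb{E}[h(-2\log\Lambda)]-\mathbb{E}[h(K)]\bigr|\le \frac{47456\,\sigma^2\,(\|h''\|+\|h'\|)}{\sqrt{n\pi}}\max\{1,\sigma^{-9}\}+418433114\,\frac{\|h'\|}{\sqrt n}\max\{1,\sigma^4\}+8\,\frac{\|h\|}{n}\Bigl(4+\frac1{\sigma^2}\Bigr),$$ where $\|\cdot\|$ denotes the supremum norm on $\mathbb{R}$. -/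

import Mathlib

open MeasureTheory ProbabilityTheory

noncomputable section

namespace LikelihoodRatio

/-- The likelihood `L(θ; x) = ∏ i, f (xᵢ | θ)` of a sample `x`, for a parametric family of
densities `f x θ`. -/
def likelihood {𝒳 Param : Type*} {n : ℕ} (f : 𝒳 → Param → ℝ) (x : Fin n → 𝒳) (θ : Param) : ℝ :=
  ∏ i, f (x i) θ

/-- The set of maximum likelihood estimates over the parameter set `S`: all points of `S` at
which the likelihood attains its maximum over `S`. -/
def mleSet {𝒳 Param : Type*} {n : ℕ} (f : 𝒳 → Param → ℝ) (S : Set Param) (x : Fin n → 𝒳) :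
    Set Param :=
  {θ | θ ∈ S ∧ IsMaxOn (likelihood f x) S θ}

/-- The maximum likelihood estimate over `S`, `argmax_{θ ∈ S} L(θ; x)`: an element of `mleSet`
(an unspecified parameter if there is none). -/
def mle {𝒳 Param : Type*} [Nonempty Param] {n : ℕ} (f : 𝒳 → Param → ℝ) (S : Set Param)
    (x : Fin n → 𝒳) : Param :=
  Classical.epsilon fun θ => θ ∈ mleSet f S x

/-- The likelihood ratio `L(θ̂_S(x); x) / L(θ₀; x)` of the maximum likelihood estimate over `S`
against the parameter `θ₀`. -/
def maxLikelihoodRatio {𝒳 Param : Type*} [Nonempty Param] {n : ℕ} (f : 𝒳 → Param → ℝ)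
    (S : Set Param) (θ₀ : Param) (x : Fin n → 𝒳) : ℝ :=
  likelihood f x (mle f S x) / likelihood f x θ₀

/-- The log-likelihood ratio statistic `-2 log Λ = 2 log (T₁ / T₂)` for testing `θ ∈ S₀` against
`θ ∈ S`, where `T₁` and `T₂` are the ratios of the likelihoods maximised over `S` and over `S₀`
to the likelihood at the true parameter `θ₀`. -/
def negTwoLogLambda {𝒳 Param : Type*} [Nonempty Param] {n : ℕ} (f : 𝒳 → Param → ℝ)
    (S S₀ : Set Param) (θ₀ : Param) (x : Fin n → 𝒳) : ℝ :=
  2 * Real.log (maxLikelihoodRatio f S θ₀ x / maxLikelihoodRatio f S₀ θ₀ x)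

/-- The density of the normal distribution, with parameter `θ = (mean, variance)`. -/
def normalDensity (x : ℝ) (θ : ℝ × ℝ) : ℝ :=
  gaussianPDFReal θ.1 θ.2.toNNReal x

/-- The parameter space `ℝ × (0, ∞)` of the normal model. -/
def normalParams : Set (ℝ × ℝ) := {θ | 0 < θ.2}

/-- The parameters of the normal model that satisfy the null hypothesis `mean = 0`. -/
def normalNullParams : Set (ℝ × ℝ) := {θ | θ ∈ normalParams ∧ θ.1 = 0}

/-- The sample mean. -/
def sampleMean {n : ℕ} (x : Fin n → ℝ) : ℝ := (∑ i, x i) / n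

/-- The chi-square distribution with `r` degrees of freedom: the law of the sum of the squares of
`r` independent standard normal random variables. -/
def chiSquared (r : ℕ) : Measure ℝ :=
  (Measure.pi fun _ : Fin r => gaussianReal 0 1).map fun z => ∑ i, z i ^ 2

/-- `h` is bounded and twice continuously differentiable, with bounded first and second
derivatives. -/
structure IsCb2 (h : ℝ → ℝ) : Prop where
  contDiff : ContDiff ℝ 2 h
  bounded : ∃ C, ∀ x, |h x| ≤ C
  bounded_deriv : ∃ C, ∀ x, |deriv h x| ≤ C
  bounded_deriv2 : ∃ C, ∀ x, |deriv (deriv h) x| ≤ C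

/-- The supremum norm of a bounded real function. -/
def supNorm (g : ℝ → ℝ) : ℝ := ⨆ x, |g x|

end LikelihoodRatio

end

/-!
Maximising the normal likelihood over the variance leaves a function of the mean squared deviation
alone, so under `H₀`, in terms of the standardised observations `Yᵢ = Xᵢ / σ`,
`-2 log Λ = n log (Q / (Q - V))` with `Q = ∑ Yᵢ²` and `V = ((∑ Yᵢ) / √n)²`.
Here `V` has exactly the `χ²₁` distribution, so no Gaussian approximation is needed: it suffices to
compare `-2 log Λ` with `V` on the same probability space. Where `Q - V ≥ n / 4`, the bounds
`1 - 1 / u ≤ log u ≤ u - 1` give `|-2 log Λ - V| ≤ (4 / n) V (|Q - n| + V)`, and the moments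
`E V² = 3` and `E (Q - n)² = 2 n` make this `O(1 / √n)` in mean; the remaining event has probability
`O(1 / n)`, and there the test function is merely bounded.
-/

open scoped Nat NNReal Real

namespace LikelihoodRatio

section GeneralModel

variable {𝒳 Param : Type*} {n : ℕ} {f : 𝒳 → Param → ℝ} {S S₀ : Set Param} {x : Fin n → 𝒳}
  {θ θ' θ₀ : Param}

lemma mleSet_eq_singleton (hθ : θ ∈ S)
    (hlt : ∀ ϑ ∈ S, ϑ ≠ θ → likelihood f x ϑ < likelihood f x θ) : mleSet f S x = {θ} := by
  refine Set.eq_singleton_iff_unique_mem.2 ⟨⟨hθ, fun ϑ hϑ => ?_⟩, fun ϑ ⟨hϑ, hmax⟩ => ?_⟩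
  · rcases eq_or_ne ϑ θ with rfl | hne
    · exact le_refl (likelihood f x ϑ)
    · exact (hlt ϑ hϑ hne).le
  · by_contra hne
    exact (hlt ϑ hϑ hne).not_ge (hmax hθ)

variable [Nonempty Param]

lemma mle_eq_of_mleSet_eq_singleton (h : mleSet f S x = {θ}) : mle f S x = θ := by
  have hmem : mle f S x ∈ mleSet f S x :=
    Classical.epsilon_spec (p := fun ϑ => ϑ ∈ mleSet f S x) ⟨θ, h ▸ Set.mem_singleton θ⟩
  rwa [h] at hmem

lemma negTwoLogLambda_eq_of_mleSet_eq_singleton (h : mleSet f S x = {θ})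
    (h₀ : mleSet f S₀ x = {θ'}) (hpos : 0 < likelihood f x θ) (hpos' : 0 < likelihood f x θ')
    (htrue : likelihood f x θ₀ ≠ 0) :
    negTwoLogLambda f S S₀ θ₀ x =
      2 * (Real.log (likelihood f x θ) - Real.log (likelihood f x θ')) := by
  rw [negTwoLogLambda, maxLikelihoodRatio, maxLikelihoodRatio, mle_eq_of_mleSet_eq_singleton h,
    mle_eq_of_mleSet_eq_singleton h₀, div_div_div_cancel_right₀ htrue,
    Real.log_div hpos.ne' hpos'.ne']

end GeneralModel

section MeanSqDev

variable {n : ℕ} {x : Fin n → ℝ}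

/-- The mean squared deviation of the sample `x` from the point `m`. The normal likelihood depends
on the mean parameter only through it. -/
noncomputable def meanSqDev (x : Fin n → ℝ) (m : ℝ) : ℝ := (∑ i, (x i - m) ^ 2) / n

lemma meanSqDev_zero (x : Fin n → ℝ) : meanSqDev x 0 = (∑ i, x i ^ 2) / n := by
  simp only [meanSqDev, sub_zero]

lemma meanSqDev_eq_add_sq (hn : n ≠ 0) (x : Fin n → ℝ) (m : ℝ) :
    meanSqDev x m = meanSqDev x (sampleMean x) + (sampleMean x - m) ^ 2 := by
  have hexpand (c : ℝ) :
      meanSqDev x c = (∑ i, x i ^ 2) / n - 2 * c * sampleMean x + c ^ 2 := by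
    simp only [meanSqDev, sampleMean, sub_sq, Finset.sum_add_distrib, Finset.sum_sub_distrib,
      ← Finset.mul_sum, ← Finset.sum_mul, Finset.sum_const, Finset.card_univ, Fintype.card_fin,
      nsmul_eq_mul]
    field_simp
  rw [hexpand m, hexpand (sampleMean x)]
  ring

lemma meanSqDev_sampleMean_lt (hn : n ≠ 0) {m : ℝ} (hm : m ≠ sampleMean x) :
    meanSqDev x (sampleMean x) < meanSqDev x m := by
  rw [meanSqDev_eq_add_sq hn x m]
  exact lt_add_of_pos_right _ (pow_two_pos_of_ne_zero (sub_ne_zero.2 hm.symm))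

lemma meanSqDev_pos_of_ne {i j : Fin n} (hij : x i ≠ x j) (m : ℝ) : 0 < meanSqDev x m := by
  have hn : 0 < n := i.pos
  refine div_pos (Finset.sum_pos' (fun k _ => sq_nonneg _) ?_) (by exact_mod_cast hn)
  rcases ne_or_eq (x i) m with hi | rfl
  · exact ⟨i, Finset.mem_univ i, pow_two_pos_of_ne_zero (sub_ne_zero.2 hi)⟩
  · exact ⟨j, Finset.mem_univ j, pow_two_pos_of_ne_zero (sub_ne_zero.2 hij.symm)⟩

end MeanSqDev

section NormalModel

variable {n : ℕ} {x : Fin n → ℝ} {θ θ₀ : ℝ × ℝ} {m : ℝ}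

lemma normalDensity_pos (t : ℝ) (hθ : 0 < θ.2) : 0 < normalDensity t θ :=
  gaussianPDFReal_pos _ _ _ (Real.toNNReal_pos.2 hθ).ne'

lemma likelihood_normalDensity_pos (x : Fin n → ℝ) (hθ : 0 < θ.2) :
    0 < likelihood normalDensity x θ :=
  Finset.prod_pos fun i _ => normalDensity_pos (x i) hθ

lemma log_normalDensity (t : ℝ) (hθ : 0 < θ.2) :
    Real.log (normalDensity t θ) = -(Real.log (2 * π * θ.2) + (t - θ.1) ^ 2 / θ.2) / 2 := by
  rw [normalDensity, gaussianPDFReal, Real.coe_toNNReal _ hθ.le,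
    Real.log_mul (by positivity) (Real.exp_ne_zero _), Real.log_inv, Real.log_sqrt (by positivity),
    Real.log_exp]
  field_simp
  ring

lemma log_likelihood_normalDensity (hn : n ≠ 0) (x : Fin n → ℝ) (hθ : 0 < θ.2) :
    Real.log (likelihood normalDensity x θ) =
      -(n / 2) * (Real.log (2 * π * θ.2) + meanSqDev x θ.1 / θ.2) := by
  rw [likelihood, Real.log_prod fun i _ => (normalDensity_pos (x i) hθ).ne']
  simp only [log_normalDensity _ hθ, ← Finset.sum_div, Finset.sum_neg_distrib,
    Finset.sum_add_distrib, Finset.sum_const, Finset.card_univ, Fintype.card_fin, nsmul_eq_mul,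
    meanSqDev]
  field_simp

lemma log_likelihood_normalDensity_meanSqDev (hn : n ≠ 0) (hm : 0 < meanSqDev x m) :
    Real.log (likelihood normalDensity x (m, meanSqDev x m)) =
      -(n / 2) * (Real.log (2 * π * meanSqDev x m) + 1) := by
  rw [log_likelihood_normalDensity hn x hm, div_self hm.ne']

lemma log_add_one_lt_log_add_div {a v : ℝ} (ha : 0 < a) (hv : 0 < v) (hav : a ≠ v) :
    Real.log a + 1 < Real.log v + a / v := by
  have hlog := Real.log_lt_sub_one_of_pos (div_pos ha hv) (by rwa [Ne, div_eq_one_iff_eq hv.ne'])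
  rw [Real.log_div ha.ne' hv.ne'] at hlog
  linarith

lemma log_add_one_le_log_add_div {a v : ℝ} (ha : 0 < a) (hv : 0 < v) :
    Real.log a + 1 ≤ Real.log v + a / v := by
  rcases eq_or_ne a v with rfl | hav
  · rw [div_self ha.ne']
  · exact (log_add_one_lt_log_add_div ha hv hav).le

lemma likelihood_normalDensity_lt (hn : n ≠ 0) (hm : 0 < meanSqDev x m) (hθ : 0 < θ.2)
    (hmin : θ.1 ≠ m → meanSqDev x m < meanSqDev x θ.1) (hne : θ ≠ (m, meanSqDev x m)) :
    likelihood normalDensity x θ < likelihood normalDensity x (m, meanSqDev x m) := by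
  have hn' : (0 : ℝ) < n := by exact_mod_cast hn.bot_lt
  have hkey : Real.log (meanSqDev x m) + 1 < Real.log θ.2 + meanSqDev x θ.1 / θ.2 := by
    rcases eq_or_ne θ.1 m with hmean | hmean
    · rw [hmean]
      exact log_add_one_lt_log_add_div hm hθ fun hvar => hne (Prod.ext hmean hvar.symm)
    · calc Real.log (meanSqDev x m) + 1 ≤ Real.log θ.2 + meanSqDev x m / θ.2 :=
            log_add_one_le_log_add_div hm hθ
        _ < Real.log θ.2 + meanSqDev x θ.1 / θ.2 := by gcongr; exact hmin hmean
  rw [← Real.log_lt_log_iff (likelihood_normalDensity_pos x hθ) (likelihood_normalDensity_pos x hm),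
    log_likelihood_normalDensity hn x hθ, log_likelihood_normalDensity_meanSqDev hn hm,
    Real.log_mul (by positivity) hθ.ne', Real.log_mul (by positivity) hm.ne']
  refine mul_lt_mul_of_neg_left ?_ (by linarith)
  linarith

lemma mleSet_normalParams (hn : n ≠ 0) (hpos : 0 < meanSqDev x (sampleMean x)) :
    mleSet normalDensity normalParams x = {(sampleMean x, meanSqDev x (sampleMean x))} :=
  mleSet_eq_singleton hpos fun _ hθ hne =>
    likelihood_normalDensity_lt hn hpos hθ (meanSqDev_sampleMean_lt hn) hne

lemma mleSet_normalNullParams (hn : n ≠ 0) (hpos : 0 < meanSqDev x 0) :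
    mleSet normalDensity normalNullParams x = {(0, meanSqDev x 0)} :=
  mleSet_eq_singleton ⟨hpos, rfl⟩ fun _ hθ hne =>
    likelihood_normalDensity_lt hn hpos hθ.1 (fun h => absurd hθ.2 h) hne

lemma negTwoLogLambda_normal (hn : n ≠ 0) (hθ₀ : 0 < θ₀.2)
    (hpos : 0 < meanSqDev x (sampleMean x)) :
    negTwoLogLambda normalDensity normalParams normalNullParams θ₀ x =
      n * Real.log (meanSqDev x 0 / meanSqDev x (sampleMean x)) := by
  have hpos₀ : 0 < meanSqDev x 0 := by
    rw [meanSqDev_eq_add_sq hn]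
    positivity
  rw [negTwoLogLambda_eq_of_mleSet_eq_singleton (mleSet_normalParams hn hpos)
      (mleSet_normalNullParams hn hpos₀) (likelihood_normalDensity_pos x hpos)
      (likelihood_normalDensity_pos x hpos₀) (likelihood_normalDensity_pos x hθ₀).ne',
    log_likelihood_normalDensity_meanSqDev hn hpos, log_likelihood_normalDensity_meanSqDev hn hpos₀,
    Real.log_mul (by positivity) hpos.ne', Real.log_mul (by positivity) hpos₀.ne',
    Real.log_div hpos₀.ne' hpos.ne']
  ring

/-- The scale `c` cancels; it is there to pass to standardised observations. -/
lemma negTwoLogLambda_normal_eq_mul_log_div_sub (hn : n ≠ 0) (hθ₀ : 0 < θ₀.2)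
    (hpos : 0 < meanSqDev x (sampleMean x)) {c : ℝ} (hc : c ≠ 0) :
    negTwoLogLambda normalDensity normalParams normalNullParams θ₀ x =
      n * Real.log ((∑ i, (x i / c) ^ 2) /
        (∑ i, (x i / c) ^ 2 - ((∑ i, x i / c) / √n) ^ 2)) := by
  have hn' : (n : ℝ) ≠ 0 := by exact_mod_cast hn
  have hnull : ∑ i, (x i / c) ^ 2 = n / c ^ 2 * meanSqDev x 0 := by
    simp only [div_pow, ← Finset.sum_div, meanSqDev_zero]
    field_simp
  have hmean : ((∑ i, x i / c) / √n) ^ 2 = n / c ^ 2 * sampleMean x ^ 2 := by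
    rw [div_pow, Real.sq_sqrt n.cast_nonneg, ← Finset.sum_div, sampleMean]
    field_simp
  have hfull : meanSqDev x (sampleMean x) = meanSqDev x 0 - sampleMean x ^ 2 := by
    rw [meanSqDev_eq_add_sq hn x 0]
    ring
  rw [negTwoLogLambda_normal hn hθ₀ hpos, hnull, hmean, ← mul_sub, ← hfull,
    mul_div_mul_left _ _ (by positivity)]

end NormalModel

section GaussianMoments

lemma integral_pow_two_mul_gaussianReal_one (k : ℕ) :
    ∫ x, x ^ (2 * k) ∂gaussianReal 0 1 = (2 * k - 1 : ℕ)‼ := by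
  have habs (x : ℝ) : gaussianPDFReal 0 1 x • x ^ (2 * k) =
      (√(2 * π))⁻¹ * (|x| ^ (2 * k : ℝ) * Real.exp (-(1 / 2) * |x| ^ (2 : ℝ))) := by
    have hpow : |x| ^ (2 * k : ℝ) = x ^ (2 * k) := by
      rw [← (even_two_mul k).pow_abs]
      exact_mod_cast Real.rpow_natCast |x| (2 * k)
    rw [hpow, Real.rpow_two, sq_abs]
    simp only [gaussianPDFReal, smul_eq_mul, NNReal.coe_one, mul_one, sub_zero]
    ring_nf
  have hscale : (1 / 2 : ℝ) ^ (-(2 * k + 1 : ℝ) / 2) = 2 ^ k * √2 := by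
    rw [one_div, neg_div, Real.inv_rpow zero_le_two, ← Real.rpow_neg zero_le_two, neg_neg,
      Real.sqrt_eq_rpow, ← Real.rpow_natCast, ← Real.rpow_add two_pos]
    ring_nf
  rw [integral_gaussianReal_eq_integral_smul one_ne_zero]
  simp only [habs]
  rw [integral_const_mul,
    integral_comp_abs (f := fun x => x ^ (2 * k : ℝ) * Real.exp (-(1 / 2) * x ^ (2 : ℝ))),
    integral_rpow_mul_exp_neg_mul_rpow two_pos
      (neg_one_lt_zero.trans_le (by positivity : (0 : ℝ) ≤ 2 * k)) one_half_pos,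
    hscale, show (2 * k + 1 : ℝ) / 2 = k + 1 / 2 by ring, Real.Gamma_nat_add_half,
    Real.sqrt_mul zero_le_two]
  field_simp

lemma integral_pow_two_mul_gaussianReal (v : ℝ≥0) (k : ℕ) :
    ∫ x, x ^ (2 * k) ∂gaussianReal 0 v = v ^ k * (2 * k - 1 : ℕ)‼ := by
  have hmap : gaussianReal 0 v = (gaussianReal 0 1).map (√v * ·) := by
    rw [gaussianReal_map_const_mul, mul_zero]
    congr 1
    ext
    simp
  rw [hmap, integral_map (by fun_prop) (by fun_prop)]
  simp only [mul_pow, pow_mul, Real.sq_sqrt v.coe_nonneg]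
  rw [integral_const_mul]
  simp only [← pow_mul, integral_pow_two_mul_gaussianReal_one]

variable {Ω : Type*} [MeasurableSpace Ω] {P : Measure Ω} {Z : Ω → ℝ} {v : ℝ≥0}

lemma memLp_sq_of_hasLaw_gaussianReal {μ : ℝ} (hZ : HasLaw Z (gaussianReal μ v) P) :
    MemLp (fun ω => Z ω ^ 2) 2 P := by
  have : IsFiniteMeasure P := hZ.isFiniteMeasure
  rw [memLp_two_iff_integrable_sq (hZ.aemeasurable.pow_const 2).aestronglyMeasurable]
  have hZ4 := (hZ.hasGaussianLaw.memLp (ENNReal.natCast_ne_top 4)).integrable_norm_pow'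
  simpa only [Real.norm_eq_abs, (show Even 4 by decide).pow_abs, ← pow_mul] using hZ4

lemma integral_sq_of_hasLaw_gaussianReal (hZ : HasLaw Z (gaussianReal 0 v) P) :
    ∫ ω, Z ω ^ 2 ∂P = v := by
  simpa using (hZ.integral_comp (f := (· ^ (2 * 1))) (by fun_prop)).trans
    (integral_pow_two_mul_gaussianReal v 1)

lemma integral_sq_sq_of_hasLaw_gaussianReal (hZ : HasLaw Z (gaussianReal 0 v) P) :
    ∫ ω, (Z ω ^ 2) ^ 2 ∂P = 3 * v ^ 2 := by
  have h := (hZ.integral_comp (f := (· ^ (2 * 2))) (by fun_prop)).trans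
    (integral_pow_two_mul_gaussianReal v 2)
  simp only [← pow_mul]
  simpa [Nat.doubleFactorial, Function.comp_def, mul_comm] using h

lemma variance_sq_of_hasLaw_gaussianReal (hZ : HasLaw Z (gaussianReal 0 v) P) :
    Var[fun ω => Z ω ^ 2; P] = 2 * v ^ 2 := by
  have : IsProbabilityMeasure P := hZ.isProbabilityMeasure
  rw [variance_eq_sub (memLp_sq_of_hasLaw_gaussianReal hZ), integral_sq_of_hasLaw_gaussianReal hZ]
  simp only [Pi.pow_apply, integral_sq_sq_of_hasLaw_gaussianReal hZ]
  ring

variable {ι : Type*} [Fintype ι] {Y : ι → Ω → ℝ} {w : ι → ℝ≥0}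

lemma memLp_sum_sq_of_hasLaw_gaussianReal {μ : ι → ℝ}
    (hlaw : ∀ i, HasLaw (Y i) (gaussianReal (μ i) (w i)) P) :
    MemLp (fun ω => ∑ i, Y i ω ^ 2) 2 P :=
  memLp_finsetSum _ fun i _ => memLp_sq_of_hasLaw_gaussianReal (hlaw i)

lemma integral_sum_sq_of_hasLaw_gaussianReal (hlaw : ∀ i, HasLaw (Y i) (gaussianReal 0 (w i)) P) :
    ∫ ω, ∑ i, Y i ω ^ 2 ∂P = ∑ i, (w i : ℝ) := by
  rw [integral_finsetSum _ fun i _ => ?_]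
  · simp only [integral_sq_of_hasLaw_gaussianReal (hlaw _)]
  · have : IsFiniteMeasure P := (hlaw i).isFiniteMeasure
    exact (memLp_sq_of_hasLaw_gaussianReal (hlaw i)).integrable one_le_two

lemma variance_sum_sq_of_hasLaw_gaussianReal (hY : iIndepFun Y P)
    (hlaw : ∀ i, HasLaw (Y i) (gaussianReal 0 (w i)) P) :
    Var[fun ω => ∑ i, Y i ω ^ 2; P] = 2 * ∑ i, (w i : ℝ) ^ 2 := by
  have hindep : Set.Pairwise (Finset.univ : Finset ι) fun i j =>
      IndepFun (fun ω => Y i ω ^ 2) (fun ω => Y j ω ^ 2) P := fun i _ j _ hij =>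
    (hY.indepFun hij).comp (measurable_id.pow_const 2) (measurable_id.pow_const 2)
  have hsum := IndepFun.variance_sum
    (fun i _ => memLp_sq_of_hasLaw_gaussianReal (hlaw i)) hindep
  simpa only [Finset.sum_fn, variance_sq_of_hasLaw_gaussianReal (hlaw _), Finset.mul_sum] using hsum

lemma integral_sum_sq_sub_sq_of_hasLaw_gaussianReal (hY : iIndepFun Y P)
    (hlaw : ∀ i, HasLaw (Y i) (gaussianReal 0 (w i)) P) :
    ∫ ω, (∑ i, Y i ω ^ 2 - ∑ i, (w i : ℝ)) ^ 2 ∂P = 2 * ∑ i, (w i : ℝ) ^ 2 := by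
  rw [← variance_sum_sq_of_hasLaw_gaussianReal hY hlaw, variance_eq_integral
    (memLp_sum_sq_of_hasLaw_gaussianReal hlaw).aemeasurable,
    integral_sum_sq_of_hasLaw_gaussianReal hlaw]

lemma hasLaw_sum_gaussianReal {μ : ι → ℝ} (hY : iIndepFun Y P)
    (hlaw : ∀ i, HasLaw (Y i) (gaussianReal (μ i) (w i)) P) :
    HasLaw (fun ω => ∑ i, Y i ω) (gaussianReal (∑ i, μ i) (∑ i, w i)) P := by
  classical
  have : IsProbabilityMeasure P := hY.isProbabilityMeasure
  suffices h : ∀ s : Finset ι,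
      HasLaw (∑ i ∈ s, Y i) (gaussianReal (∑ i ∈ s, μ i) (∑ i ∈ s, w i)) P by
    simpa only [Finset.sum_fn] using h Finset.univ
  intro s
  induction s using Finset.induction_on with
  | empty =>
    simpa using hasLaw_dirac_of_ae_eq (X := (0 : Ω → ℝ)) (x := (0 : ℝ)) (P := P) ae_eq_rfl
  | insert i s hi ih =>
    have hindep := hY.indepFun_finsetSum_of_notMem₀ (fun j => (hlaw j).aemeasurable) hi
    simpa only [Finset.sum_insert hi, gaussianReal_conv_gaussianReal] using
      hindep.symm.hasLaw_add (hlaw i) ih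

lemma hasLaw_sum_div_sqrt_card [Nonempty ι] (hY : iIndepFun Y P)
    (hlaw : ∀ i, HasLaw (Y i) (gaussianReal 0 1) P) :
    HasLaw (fun ω => (∑ i, Y i ω) / √(Fintype.card ι)) (gaussianReal 0 1) P := by
  convert! gaussianReal_div_const (hasLaw_sum_gaussianReal hY hlaw) √(Fintype.card ι) using 2
  · simp
  · ext
    simp

lemma hasLaw_div_of_hasLaw_gaussianReal {μ σ : ℝ} (hσ : σ ≠ 0)
    (hZ : HasLaw Z (gaussianReal μ (σ ^ 2).toNNReal) P) :
    HasLaw (fun ω => Z ω / σ) (gaussianReal (μ / σ) 1) P := by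
  convert! gaussianReal_div_const hZ σ using 2
  ext
  simp [hσ, sq_nonneg]

lemma hasLaw_sum_sq_chiSquared {r : ℕ} {Y : Fin r → Ω → ℝ} (hY : iIndepFun Y P)
    (hlaw : ∀ i, HasLaw (Y i) (gaussianReal 0 1) P) :
    HasLaw (fun ω => ∑ i, Y i ω ^ 2) (chiSquared r) P :=
  HasLaw.fun_comp (Y := fun z : Fin r → ℝ => ∑ i, z i ^ 2)
    ⟨Measurable.aemeasurable (by fun_prop), rfl⟩ (iIndepFun.hasLaw_pi hlaw hY)

lemma hasLaw_sq_chiSquared_one (hZ : HasLaw Z (gaussianReal 0 1) P) :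
    HasLaw (fun ω => Z ω ^ 2) (chiSquared 1) P := by
  have : IsProbabilityMeasure P := hZ.isProbabilityMeasure
  simpa using hasLaw_sum_sq_chiSquared (Y := fun _ : Fin 1 => Z) .of_subsingleton fun _ => hZ

end GaussianMoments

section NoTies

variable {Ω : Type*} [MeasurableSpace Ω] {P : Measure Ω}

lemma ae_ne_of_indepFun {𝓧 : Type*} [MeasurableSpace 𝓧] [MeasurableEq 𝓧] {U V : Ω → 𝓧}
    {ρ : Measure 𝓧} [IsFiniteMeasure P] [NullSingletonClass ρ] (hU : AEMeasurable U P)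
    (hV : HasLaw V ρ P) (hindep : IndepFun U V P) : ∀ᵐ ω ∂P, U ω ≠ V ω := by
  have : IsFiniteMeasure ρ := hV.isFiniteMeasure_iff.1 ‹_›
  have hne : MeasurableSet {p : 𝓧 × 𝓧 | p.1 ≠ p.2} :=
    (measurableSet_eq_fun measurable_fst measurable_snd).compl
  have hpair := hindep.hasLaw_prod ⟨hU, rfl⟩ hV
  rw [hpair.ae_iff (p := fun p => p.1 ≠ p.2) (measurableSet_setOfPred.1 hne),
    Measure.ae_prod_iff_ae_ae hne]
  refine .of_forall fun u => ?_
  filter_upwards [compl_mem_ae_iff.2 (measure_singleton (μ := ρ) u)] with v hv using Ne.symm hv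

lemma ae_meanSqDev_pos {n : ℕ} (hn : 2 ≤ n) {X : Fin n → Ω → ℝ} (hX : iIndepFun X P)
    {ρ : Measure ℝ} [NullSingletonClass ρ] (hlaw : ∀ i, HasLaw (X i) ρ P) :
    ∀ᵐ ω ∂P, ∀ m, 0 < meanSqDev (fun i => X i ω) m := by
  have : IsProbabilityMeasure P := hX.isProbabilityMeasure
  have hij : (⟨0, by omega⟩ : Fin n) ≠ ⟨1, by omega⟩ := by simp
  filter_upwards [ae_ne_of_indepFun (hlaw _).aemeasurable (hlaw _) (hX.indepFun hij)] with ω hω m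
  exact meanSqDev_pos_of_ne hω m

end NoTies

section LogComparison

variable {m q z : ℝ}

lemma abs_mul_log_div_sub_le (hm : 0 < m) (hz : 0 ≤ z) (hqz : m / 4 ≤ q - z) :
    |m * Real.log (q / (q - z)) - z| ≤ 4 / m * (z * (|q - m| + z)) := by
  have hqz₀ : 0 < q - z := by linarith
  have hq : 0 < q := by linarith
  have hupper : Real.log (q / (q - z)) ≤ z / (q - z) :=
    (Real.log_le_sub_one_of_pos (div_pos hq hqz₀)).trans_eq (by field_simp; ring)
  have hlower : z / q ≤ Real.log (q / (q - z)) :=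
    (Real.one_sub_inv_le_log_of_pos (div_pos hq hqz₀)).trans_eq' (by field_simp; ring)
  have hdiv {t : ℝ} (ht : m / 4 ≤ t) : z * (|q - m| + z) / t ≤ 4 / m * (z * (|q - m| + z)) :=
    (div_le_div_of_nonneg_left (by positivity) (by positivity) ht).trans_eq (by field_simp)
  refine abs_sub_le_iff.2 ⟨?_, ?_⟩
  · calc m * Real.log (q / (q - z)) - z ≤ m * (z / (q - z)) - z := by gcongr
      _ = z * (-(q - m) + z) / (q - z) := by field_simp; ring
      _ ≤ z * (|q - m| + z) / (q - z) := by gcongr; exact neg_le_abs _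
      _ ≤ 4 / m * (z * (|q - m| + z)) := hdiv hqz
  · calc z - m * Real.log (q / (q - z)) ≤ z - m * (z / q) := by gcongr
      _ = z * (q - m + 0) / q := by field_simp; ring
      _ ≤ z * (|q - m| + z) / q := by gcongr; exact le_abs_self _
      _ ≤ 4 / m * (z * (|q - m| + z)) := hdiv (hqz.trans (sub_le_self q hz))

lemma four_div_mul_mul_le (hm : 0 < m) (z d : ℝ) :
    4 / m * (z * d) ≤ 2 / √m * (z ^ 2 + d ^ 2 / m) := by
  have hamgm := two_mul_le_add_sq z (d / √m)
  calc 4 / m * (z * d) = 2 / √m * (2 * z * (d / √m)) := by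
        have := Real.sqrt_pos.2 hm
        nth_rw 1 [← Real.sq_sqrt hm.le]
        field_simp
        ring
    _ ≤ 2 / √m * (z ^ 2 + d ^ 2 / m) := by
        rw [div_pow, Real.sq_sqrt hm.le] at hamgm
        gcongr

/-- Integrated, this is Markov's inequality for `z` and Chebyshev's for `q`. -/
lemma one_le_four_mul_of_sub_lt (hm : 0 < m) (hz : 0 ≤ z) (hqz : q - z < m / 4) :
    1 ≤ 4 * (z / m + (q - m) ^ 2 / m ^ 2) := by
  have hdev : q / m - z / m < 1 / 4 := by
    rw [← sub_div, div_lt_iff₀ hm]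
    linarith
  have hsq : (q - m) ^ 2 / m ^ 2 = (q / m - 1) ^ 2 := by
    rw [← div_pow, sub_div, div_self hm.ne']
  have hz' : 0 ≤ z / m := by positivity
  rw [hsq]
  nlinarith

variable {h : ℝ → ℝ} {L : ℝ≥0} {B : ℝ}

lemma abs_comp_mul_log_div_sub_sub_le (hLip : LipschitzWith L h) (hB : ∀ x, |h x| ≤ B)
    (hm : 0 < m) (hz : 0 ≤ z) :
    |h (m * Real.log (q / (q - z))) - h z| ≤
      L * (4 / m * z ^ 2 + 2 / √m * (z ^ 2 + (q - m) ^ 2 / m)) +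
        8 * B * (z / m + (q - m) ^ 2 / m ^ 2) := by
  have hB₀ : 0 ≤ B := (abs_nonneg _).trans (hB 0)
  rcases le_or_gt (m / 4) (q - z) with hqz | hqz
  · calc |h (m * Real.log (q / (q - z))) - h z|
        ≤ L * |m * Real.log (q / (q - z)) - z| := hLip.dist_le_mul _ _
      _ ≤ L * (4 / m * (z * (|q - m| + z))) := by
        gcongr
        exact abs_mul_log_div_sub_le hm hz hqz
      _ = L * (4 / m * z ^ 2 + 4 / m * (z * |q - m|)) := by ring
      _ ≤ L * (4 / m * z ^ 2 + 2 / √m * (z ^ 2 + (q - m) ^ 2 / m)) := by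
        rw [← sq_abs (q - m)]
        gcongr L * (_ + ?_)
        exact four_div_mul_mul_le hm z |q - m|
      _ ≤ _ := le_add_of_nonneg_right (by positivity)
  · calc |h (m * Real.log (q / (q - z))) - h z|
        ≤ |h (m * Real.log (q / (q - z)))| + |h z| := abs_sub _ _
      _ ≤ 2 * B * 1 := by linarith [hB (m * Real.log (q / (q - z))), hB z]
      _ ≤ 2 * B * (4 * (z / m + (q - m) ^ 2 / m ^ 2)) := by
        gcongr
        exact one_le_four_mul_of_sub_lt hm hz hqz
      _ = 8 * B * (z / m + (q - m) ^ 2 / m ^ 2) := by ring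
      _ ≤ _ := le_add_of_nonneg_left (by positivity)

lemma integrable_comp_of_continuous_of_bounded {Ω : Type*} [MeasurableSpace Ω] {P : Measure Ω}
    [IsFiniteMeasure P] (hcont : Continuous h) (hB : ∀ x, |h x| ≤ B) {U : Ω → ℝ}
    (hU : AEMeasurable U P) : Integrable (fun ω => h (U ω)) P :=
  .of_bound (hcont.measurable.comp_aemeasurable hU).aestronglyMeasurable B
    (.of_forall fun ω => hB (U ω))

lemma abs_integral_comp_mul_log_div_sub_le {Ω : Type*} [MeasurableSpace Ω] {P : Measure Ω}
    [IsFiniteMeasure P] (hLip : LipschitzWith L h) (hB : ∀ x, |h x| ≤ B) (hm : 0 < m)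
    {Q V : Ω → ℝ} (hQ : MemLp Q 2 P) (hV : MemLp V 2 P) (hV₀ : ∀ ω, 0 ≤ V ω) :
    |∫ ω, h (m * Real.log (Q ω / (Q ω - V ω))) ∂P - ∫ ω, h (V ω) ∂P| ≤
      L * (4 / m * ∫ ω, V ω ^ 2 ∂P +
          2 / √m * (∫ ω, V ω ^ 2 ∂P + (∫ ω, (Q ω - m) ^ 2 ∂P) / m)) +
        8 * B * ((∫ ω, V ω ∂P) / m + (∫ ω, (Q ω - m) ^ 2 ∂P) / m ^ 2) := by
  have hQm := hQ.aemeasurable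
  have hVm := hV.aemeasurable
  have hV1 : Integrable V P := hV.integrable one_le_two
  have hV2 : Integrable (fun ω => V ω ^ 2) P := hV.integrable_sq
  have hQ2 : Integrable (fun ω => (Q ω - m) ^ 2) P := (hQ.sub (memLp_const m)).integrable_sq
  rw [← integral_sub
    (integrable_comp_of_continuous_of_bounded hLip.continuous hB (by fun_prop))
    (integrable_comp_of_continuous_of_bounded hLip.continuous hB hVm)]
  calc |∫ ω, h (m * Real.log (Q ω / (Q ω - V ω))) - h (V ω) ∂P|
      ≤ ∫ ω, L * (4 / m * V ω ^ 2 + 2 / √m * (V ω ^ 2 + (Q ω - m) ^ 2 / m)) +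
          8 * B * (V ω / m + (Q ω - m) ^ 2 / m ^ 2) ∂P := by
        rw [← Real.norm_eq_abs]
        exact norm_integral_le_of_norm_le (by fun_prop) (.of_forall fun ω =>
          abs_comp_mul_log_div_sub_sub_le hLip hB hm (hV₀ ω))
    _ = _ := by
        rw [integral_add (by fun_prop) (by fun_prop), integral_const_mul, integral_const_mul,
          integral_add (by fun_prop) (by fun_prop), integral_const_mul, integral_const_mul,
          integral_add (by fun_prop) (by fun_prop), integral_add (by fun_prop) (by fun_prop),
          integral_div, integral_div, integral_div]

end LogComparison

section TestFunctions

variable {h : ℝ → ℝ}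

lemma supNorm_nonneg (h : ℝ → ℝ) : 0 ≤ supNorm h := Real.iSup_nonneg fun _ => abs_nonneg _

lemma abs_le_supNorm (hbdd : ∃ C, ∀ x, |h x| ≤ C) (x : ℝ) : |h x| ≤ supNorm h :=
  le_ciSup (f := fun x => |h x|) (hbdd.imp fun _ hC => Set.forall_mem_range.2 hC) x

lemma IsCb2.lipschitzWith (hh : IsCb2 h) :
    LipschitzWith ⟨supNorm (deriv h), supNorm_nonneg _⟩ h :=
  lipschitzWith_of_nnnorm_deriv_le (hh.contDiff.differentiable two_ne_zero)
    fun x => abs_le_supNorm hh.bounded_deriv x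

lemma lipschitz_rate_le_cb2_rate {σ H D D₂ : ℝ} (hH : 0 ≤ H) (hD : 0 ≤ D) (hD₂ : 0 ≤ D₂) (n : ℕ) :
    22 * (D / √n) + 24 * (H / n) ≤
      47456 * σ ^ 2 * (D₂ + D) / √(n * π) * max 1 (σ ^ (-9 : ℤ)) +
        418433114 * (D / √n) * max 1 (σ ^ 4) + 8 * (H / n) * (4 + 1 / σ ^ 2) := by
  have hfirst : 22 * (D / √n) ≤ 418433114 * (D / √n) * max 1 (σ ^ 4) :=
    calc 22 * (D / √n) ≤ 418433114 * (D / √n) := by gcongr; norm_num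
      _ ≤ _ := le_mul_of_one_le_right (by positivity) (le_max_left _ _)
  have hsecond : 24 * (H / n) ≤ 8 * (H / n) * (4 + 1 / σ ^ 2) :=
    calc 24 * (H / n) = 8 * (H / n) * (3 + 0) := by ring
      _ ≤ 8 * (H / n) * (4 + 1 / σ ^ 2) := by gcongr <;> [norm_num; positivity]
  calc 22 * (D / √n) + 24 * (H / n)
      ≤ 418433114 * (D / √n) * max 1 (σ ^ 4) + 8 * (H / n) * (4 + 1 / σ ^ 2) :=
        add_le_add hfirst hsecond
    _ ≤ _ := by
        rw [add_assoc]
        exact le_add_of_nonneg_left (by positivity)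

end TestFunctions

section ChiSquaredApproximation

variable {Ω : Type*} [MeasurableSpace Ω] {P : Measure Ω} {n : ℕ} {h : ℝ → ℝ} {L : ℝ≥0} {B : ℝ}

lemma abs_integral_comp_mul_log_sum_sq_sub_le (hn : n ≠ 0) {Y : Fin n → Ω → ℝ} (hY : iIndepFun Y P)
    (hlaw : ∀ i, HasLaw (Y i) (gaussianReal 0 1) P) (hLip : LipschitzWith L h)
    (hB : ∀ x, |h x| ≤ B) :
    |∫ ω, h (n * Real.log ((∑ i, Y i ω ^ 2) /
        (∑ i, Y i ω ^ 2 - ((∑ i, Y i ω) / √n) ^ 2))) ∂P - ∫ x, h x ∂chiSquared 1| ≤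
      22 * (L / √n) + 24 * (B / n) := by
  have : NeZero n := ⟨hn⟩
  have : IsProbabilityMeasure P := hY.isProbabilityMeasure
  have hn₁ : (1 : ℝ) ≤ n := by exact_mod_cast hn.bot_lt
  have hZ : HasLaw (fun ω => (∑ i, Y i ω) / √n) (gaussianReal 0 1) P := by
    simpa only [Fintype.card_fin] using hasLaw_sum_div_sqrt_card hY hlaw
  have hchi : ∫ x, h x ∂chiSquared 1 = ∫ ω, h (((∑ i, Y i ω) / √n) ^ 2) ∂P :=
    ((hasLaw_sq_chiSquared_one hZ).integral_comp hLip.continuous.aestronglyMeasurable).symm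
  have hvar := integral_sum_sq_sub_sq_of_hasLaw_gaussianReal hY hlaw
  simp only [NNReal.coe_one, Finset.sum_const, Finset.card_univ, Fintype.card_fin, nsmul_eq_mul,
    mul_one, one_pow] at hvar
  have hbound := abs_integral_comp_mul_log_div_sub_le hLip hB (zero_lt_one.trans_le hn₁)
    (memLp_sum_sq_of_hasLaw_gaussianReal hlaw) (memLp_sq_of_hasLaw_gaussianReal hZ)
    fun ω => sq_nonneg _
  rw [← hchi, integral_sq_of_hasLaw_gaussianReal hZ, integral_sq_sq_of_hasLaw_gaussianReal hZ,
    hvar] at hbound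
  calc _ ≤ _ := hbound
    _ = L * (12 / n + 10 / √n) + 24 * (B / n) := by
        push_cast
        field_simp
        ring
    _ ≤ L * (12 / √n + 10 / √n) + 24 * (B / n) := by
        gcongr
        exact Real.sqrt_le_self_iff.2 (.inr hn₁)
    _ = 22 * (L / √n) + 24 * (B / n) := by ring

lemma negTwoLogLambda_normal_ae_eq (hn : 2 ≤ n) {μ σ : ℝ} (hσ : σ ≠ 0) {X : Fin n → Ω → ℝ}
    (hX : iIndepFun X P) (hlaw : ∀ i, HasLaw (X i) (gaussianReal μ (σ ^ 2).toNNReal) P)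
    {θ₀ : ℝ × ℝ} (hθ₀ : 0 < θ₀.2) :
    (fun ω => negTwoLogLambda normalDensity normalParams normalNullParams θ₀ fun i => X i ω) =ᵐ[P]
      fun ω => n * Real.log ((∑ i, (X i ω / σ) ^ 2) /
        (∑ i, (X i ω / σ) ^ 2 - ((∑ i, X i ω / σ) / √n) ^ 2)) := by
  have : NullSingletonClass (gaussianReal μ (σ ^ 2).toNNReal) :=
    nullSingletonClass_gaussianReal (by simpa using hσ)
  filter_upwards [ae_meanSqDev_pos hn hX hlaw] with ω hω
  exact negTwoLogLambda_normal_eq_mul_log_div_sub (by omega) hθ₀ (hω _) hσ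

end ChiSquaredApproximation

end LikelihoodRatio

theorem corollary2_general {Ω Ω' : Type*} [MeasurableSpace Ω] [MeasurableSpace Ω']
    (P : Measure Ω) [IsProbabilityMeasure P] (P' : Measure Ω') [IsProbabilityMeasure P']
    (n : ℕ) (hn : 2 ≤ n) (μ σ : ℝ) (hσ : σ ≠ 0)
    (X : Fin n → Ω → ℝ) (hX : iIndepFun X P)
    (hlaw : ∀ i, HasLaw (X i) (gaussianReal μ (σ ^ 2).toNNReal) P)
    (K : Ω' → ℝ) (hK : HasLaw K (LikelihoodRatio.chiSquared 1) P') :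
    (∀ᵐ ω ∂P,
      LikelihoodRatio.mleSet LikelihoodRatio.normalDensity LikelihoodRatio.normalParams
          (fun i => X i ω) =
        {(LikelihoodRatio.sampleMean (fun i => X i ω),
          (∑ i, (X i ω - LikelihoodRatio.sampleMean (fun j => X j ω)) ^ 2) / n)} ∧
      LikelihoodRatio.mleSet LikelihoodRatio.normalDensity LikelihoodRatio.normalNullParams
          (fun i => X i ω) =
        {((0 : ℝ), (∑ i, X i ω ^ 2) / n)}) ∧
    ((μ, σ ^ 2) ∈ LikelihoodRatio.normalNullParams →
      ∀ (h : ℝ → ℝ) {L : ℝ≥0} {B : ℝ}, LipschitzWith L h → (∀ x, |h x| ≤ B) →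
        Integrable (fun ω => h (LikelihoodRatio.negTwoLogLambda LikelihoodRatio.normalDensity
          LikelihoodRatio.normalParams LikelihoodRatio.normalNullParams (μ, σ ^ 2)
          (fun i => X i ω))) P ∧
        Integrable (fun ω => h (K ω)) P' ∧
        |(∫ ω, h (LikelihoodRatio.negTwoLogLambda LikelihoodRatio.normalDensity
            LikelihoodRatio.normalParams LikelihoodRatio.normalNullParams (μ, σ ^ 2)
            (fun i => X i ω)) ∂P) - ∫ ω, h (K ω) ∂P'| ≤
          22 * (L / √n) + 24 * (B / n)) := by
  have hn₀ : n ≠ 0 := by omega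
  have : NullSingletonClass (gaussianReal μ (σ ^ 2).toNNReal) :=
    nullSingletonClass_gaussianReal (by simpa using hσ)
  refine ⟨?_, ?_⟩
  · filter_upwards [LikelihoodRatio.ae_meanSqDev_pos hn hX hlaw] with ω hω
    refine ⟨LikelihoodRatio.mleSet_normalParams hn₀ (hω _), ?_⟩
    simpa only [LikelihoodRatio.meanSqDev_zero] using
      LikelihoodRatio.mleSet_normalNullParams hn₀ (hω 0)
  · rintro ⟨hvar, rfl : μ = 0⟩ h L B hLip hB
    have hstat := LikelihoodRatio.negTwoLogLambda_normal_ae_eq hn hσ hX hlaw hvar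
    have (i : Fin n) : AEMeasurable (X i) P := (hlaw i).aemeasurable
    have hY : iIndepFun (fun i ω => X i ω / σ) P :=
      hX.comp (fun _ t => t / σ) fun _ => measurable_id.div_const σ
    have hYlaw (i : Fin n) : HasLaw (fun ω => X i ω / σ) (gaussianReal 0 1) P := by
      simpa only [zero_div] using LikelihoodRatio.hasLaw_div_of_hasLaw_gaussianReal hσ (hlaw i)
    refine ⟨LikelihoodRatio.integrable_comp_of_continuous_of_bounded hLip.continuous hB
        (AEMeasurable.congr (by fun_prop) hstat.symm),
      LikelihoodRatio.integrable_comp_of_continuous_of_bounded hLip.continuous hB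
        hK.aemeasurable, ?_⟩
    have hchi : ∫ ω, h (K ω) ∂P' = ∫ x, h x ∂LikelihoodRatio.chiSquared 1 :=
      hK.integral_comp hLip.continuous.aestronglyMeasurable
    rw [hchi, integral_congr_ae (hstat.mono fun _ => congrArg h)]
    exact LikelihoodRatio.abs_integral_comp_mul_log_sum_sq_sub_le hn₀ hY hYlaw hLip hB

theorem corollary2 {Ω Ω' : Type*} [MeasurableSpace Ω] [MeasurableSpace Ω']
    (P : Measure Ω) [IsProbabilityMeasure P] (P' : Measure Ω') [IsProbabilityMeasure P']
    (n : ℕ) (hn : 2 ≤ n) (μ σ : ℝ) (hσ : 0 < σ)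
    (X : Fin n → Ω → ℝ) (hX : iIndepFun X P)
    (hlaw : ∀ i, HasLaw (X i) (gaussianReal μ (σ ^ 2).toNNReal) P)
    (K : Ω' → ℝ) (hK : HasLaw K (LikelihoodRatio.chiSquared 1) P') :
    -- the MLE exists, is unique, and has the stated form, over the full and the null parameter set
    (∀ᵐ ω ∂P,
      LikelihoodRatio.mleSet LikelihoodRatio.normalDensity LikelihoodRatio.normalParams
          (fun i => X i ω) =
        {(LikelihoodRatio.sampleMean (fun i => X i ω),
          (∑ i, (X i ω - LikelihoodRatio.sampleMean (fun j => X j ω)) ^ 2) / n)} ∧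
      LikelihoodRatio.mleSet LikelihoodRatio.normalDensity LikelihoodRatio.normalNullParams
          (fun i => X i ω) =
        {((0 : ℝ), (∑ i, X i ω ^ 2) / n)}) ∧
    -- under the null hypothesis, the distance to the chi-square distribution
    ((μ, σ ^ 2) ∈ LikelihoodRatio.normalNullParams →
      ∀ h : ℝ → ℝ, LikelihoodRatio.IsCb2 h →
        Integrable (fun ω => h (LikelihoodRatio.negTwoLogLambda LikelihoodRatio.normalDensity
          LikelihoodRatio.normalParams LikelihoodRatio.normalNullParams (μ, σ ^ 2)
          (fun i => X i ω))) P ∧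
        Integrable (fun ω => h (K ω)) P' ∧
        |(∫ ω, h (LikelihoodRatio.negTwoLogLambda LikelihoodRatio.normalDensity
            LikelihoodRatio.normalParams LikelihoodRatio.normalNullParams (μ, σ ^ 2)
            (fun i => X i ω)) ∂P) - ∫ ω, h (K ω) ∂P'| ≤
          47456 * σ ^ 2 * (LikelihoodRatio.supNorm (deriv (deriv h)) +
              LikelihoodRatio.supNorm (deriv h)) / √(n * Real.pi) * max 1 (σ ^ (-9 : ℤ)) +
            418433114 * (LikelihoodRatio.supNorm (deriv h) / √n) * max 1 (σ ^ 4) +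
            8 * (LikelihoodRatio.supNorm h / n) * (4 + 1 / σ ^ 2)) :=
  (corollary2_general P P' n hn μ σ hσ.ne' X hX hlaw K hK).imp_right fun hdist hnull h hh =>
    (hdist hnull h hh.lipschitzWith (LikelihoodRatio.abs_le_supNorm hh.bounded)).imp_right <|
      And.imp_right fun hle => hle.trans <|
        LikelihoodRatio.lipschitz_rate_le_cb2_rate (LikelihoodRatio.supNorm_nonneg _)
          (LikelihoodRatio.supNorm_nonneg _) (LikelihoodRatio.supNorm_nonneg _) n
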